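/- Let $(X,d,\mu)$ be a complete metric space with a Borel regular outer measure $\mu$ that is doubling, $0<\mu(B(x,2r))\le C_d\,\mu(B(x,r))<\infty$ for all $x\in X$, $r>0$, where $C_d\ge 1$ and $B(x,r)=\{y: d(x,y)<r\}$. Functions take values in $[-\infty,\infty]$, and $u_B=\frac1{\mu(B)}\int_B u\,d\mu$. A curve is a rectifiable continuous map from a compact interval into $X$; curve integrals are taken with respect to arc length. A Borel function $g\ge 0$ is an upper gradient of $u$ on $X$ if $$|u(x)-u(y)|\le\int_\gamma g\,ds \qquad (1)$$ for every nonconstant curve $\gamma$ in $X$ with end points $x,y$ (the left side is $\infty$ if $u(x)$ or $u(y)$ is infinite). A measurable $g\ge0$ on a set $H$ is a $1$-weak upper gradient of $u$ in $H$ if (1) holds for all nonconstant curves in $H$ except for a family $\Gamma$ for which there is a Borel function $\rho\ge 0$ in $L^1(X)$ with $\int_\gamma\rho\,ds=\infty$ for all $\gamma\in\Gamma$. Suppose that $X$ supports a $(1,1)$-Poincaré inequality: there are $C_P>0$ and $\lambda\ge1$ such that for every ball $B(x,r)$, every $u\in L^1_{\rm loc}(X)$ and every upper gradient $g$ of $u$,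 $$\frac1{\mu(B(x,r))}\int_{B(x,r)}|u-u_{B(x,r)}|\,d\mu\le \frac{C_P\,r}{\mu(B(x,\lambda r))}\int_{B(x,\lambda r)}g\,d\mu .$$ Let $\Omega\subset X$ be a nonempty open set with nonempty complement. Put $\|u\|_{N^{1,1}(\Omega)}=\|u\|_{L^1(\Omega)}+\inf\|g\|_{L^1(\Omega)}$, the infimum over all $1$-weak upper gradients $g$ of $u$ in $\Omega$, and let $N^{1,1}(\Omega)$ be the set of measurable $u$ for which this is finite. For $0<c_H<1$ let $M^{1,1}_{c_H}(\Omega)$ be the set of $v\in L^1(\Omega)$ for which there are $0\le g\in L^1(\Omega)$ and a set $A\subset\Omega$ of measure zero such that $|v(x)-v(y)|\le d(x,y)(g(x)+g(y))$ for all $x,y\in\Omega\setminus A$ with $d(x,y)\le c_H\min\{d(x,X\setminus\Omega),d(y,X\setminus\Omega)\}$, with norm $\|v\|_{M^{1,1}_{c_H}(\Omega)}=\|v\|_{L^1(\Omega)}+\inf\|g\|_{L^1(\Omega)}$, the infimum over all such $g$. Let $B_j=B(x_j,r_j)$, $j\in\mathbb N$, with $x_j\in\Omega$, be a Whitney covering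 of $\Omega$: $\Omega=\bigcup_jB_j$; $r_j=d(x_j,X\setminus\Omega)/(100\lambda)$; for each $k$, the ball $20\lambda B_k:=B(x_k,20\lambda r_k)$ meets $20\lambda B_j$ for at most $C_0$ indices $j$; and $r_j\le 2r_k$ whenever $20\lambda B_k$ meets $20\lambda B_j$. Let $(\phi_j)$ be a partition of unity subordinate to it: for a constant $c>0$, each $\phi_j$ is $c/r_j$-Lipschitz on $\Omega$, $0\le\phi_j\le1$, $\phi_j=0$ in $\Omega\setminus 2B_j$, and $\sum_j\phi_j=1$ on $\Omega$. For $u\in N^{1,1}(\Omega)$ let $u_W=\sum_j u_{B_j}\phi_j$ be its discrete convolution. **Theorem 4.1.** Let $c_H=1/(50\lambda)$. There is a constant $C>0$ depending only on $C_d$, $C_P$, $\lambda$, $C_0$ and $c$ such that, for all $X$, $\mu$, $\Omega$, $(B_j)$ and $(\phi_j)$ as above and every $u\in N^{1,1}(\Omega)$, we have $u_W\in M^{1,1}_{c_H}(\Omega)$ and $$\|u_W\|_{M^{1,1}_{c_H}(\Omega)}\le C\,\|u\|_{N^{1,1}(\Omega)} .$$ -/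

import Mathlib

open MeasureTheory Set Metric
open scoped ENNReal

noncomputable section

namespace MetricSobolev

variable {X : Type*} [MetricSpace X]

/-- A curve: a continuous map of finite length (a rectifiable map) from a compact interval
`[a, b]` of the real line into `X`. Only the values of `toFun` on `[a, b]` matter. -/
structure Curve (X : Type*) [MetricSpace X] where
  /-- left end point of the parameter interval -/
  a : ℝ
  /-- right end point of the parameter interval -/
  b : ℝ
  le : a ≤ b
  /-- the map -/
  toFun : ℝ → X
  continuousOn : ContinuousOn toFun (Icc a b)
  rectifiable : eVariationOn toFun (Icc a b) < ∞

/-- The image of a curve. -/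
def Curve.image (γ : Curve X) : Set X := γ.toFun '' Icc γ.a γ.b

/-- A curve is nonconstant if its image has at least two points. -/
def Curve.Nonconstant (γ : Curve X) : Prop := γ.image.Nontrivial

/-- The length of a curve. -/
def Curve.length (γ : Curve X) : ℝ := (eVariationOn γ.toFun (Icc γ.a γ.b)).toReal

/-- The arc-length parametrization of a curve, to be used on `[0, γ.length]`. -/
def Curve.arcParam (γ : Curve X) : ℝ → X := naturalParameterization γ.toFun (Icc γ.a γ.b) γ.a

/-- The curve integral `∫_γ g ds`, by means of the arc-length parametrization. -/
def Curve.integral (γ : Curve X) (g : X → ℝ≥0∞) : ℝ≥0∞ :=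
  ∫⁻ t in Icc 0 γ.length, g (γ.arcParam t)

/-- The inequality `|u(x) - u(y)| ≤ ∫_γ g ds`, where `x`, `y` are the end points of `γ`. In `EReal`
the difference of two values one of which is infinite is infinite, so that the left side is `∞` as
soon as one of `u(x)`, `u(y)` is infinite. -/
def UpperGradientIneq (u : X → EReal) (g : X → ℝ≥0∞) (γ : Curve X) : Prop :=
  (u (γ.toFun γ.a) - u (γ.toFun γ.b)).abs ≤ γ.integral g

variable [MeasurableSpace X]

/-- A nonnegative Borel function `g` on `X` is an upper gradient of `u` on `X`. -/
def IsUpperGradient (u : X → EReal) (g : X → ℝ≥0∞) : Prop :=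
  Measurable g ∧ ∀ γ : Curve X, γ.Nonconstant → UpperGradientIneq u g γ

/-- A family of curves has zero `1`-modulus. -/
def ZeroModulus (μ : Measure X) (Γ : Set (Curve X)) : Prop :=
  ∃ ρ : X → ℝ≥0∞, Measurable ρ ∧ ∫⁻ x, ρ x ∂μ < ∞ ∧ ∀ γ ∈ Γ, γ.integral ρ = ∞

/-- `g` is a `1`-weak upper gradient of `u` in `H`: a nonnegative measurable function on `H` such
that the upper gradient inequality holds for `1`-almost every nonconstant curve in `H`. -/
def IsWeakUpperGradientOn (μ : Measure X) (H : Set X) (u : X → EReal) (g : X → ℝ≥0∞) : Prop :=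
  AEMeasurable g (μ.restrict H) ∧
    ZeroModulus μ {γ : Curve X | γ.Nonconstant ∧ γ.image ⊆ H ∧ ¬ UpperGradientIneq u g γ}

/-- The `L¹(H)` norm of an extended real-valued function. -/
def L1norm (μ : Measure X) (H : Set X) (u : X → EReal) : ℝ≥0∞ := ∫⁻ x in H, (u x).abs ∂μ

/-- `u ∈ L¹(H)`. -/
def MemL1 (μ : Measure X) (H : Set X) (u : X → EReal) : Prop :=
  AEMeasurable u (μ.restrict H) ∧ L1norm μ H u < ∞

/-- `u ∈ L¹_loc(Ω)`: `u ∈ L¹(Ω')` for each open `Ω'` whose closure is a compact subset of `Ω`. -/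
def MemL1Loc (μ : Measure X) (Ω : Set X) (u : X → EReal) : Prop :=
  ∀ Ω' : Set X, IsOpen Ω' → IsCompact (closure Ω') → closure Ω' ⊆ Ω → MemL1 μ Ω' u

/-- The norm `‖u‖_{N^{1,1}(H)}`; it is `∞` if no `1`-weak upper gradient is integrable. -/
def N11norm (μ : Measure X) (H : Set X) (u : X → EReal) : ℝ≥0∞ :=
  L1norm μ H u + ⨅ (g : X → ℝ≥0∞) (_ : IsWeakUpperGradientOn μ H u g), ∫⁻ x in H, g x ∂μ

/-- `u ∈ N^{1,1}(H)`. -/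
def MemN11 (μ : Measure X) (H : Set X) (u : X → EReal) : Prop :=
  AEMeasurable u (μ.restrict H) ∧ N11norm μ H u < ∞

/-- `0 ≤ g ∈ L¹(K)` is admissible for `v` in the definition of `M^{1,1}_{cH}(K)`. The distance to
an empty complement is `∞`. -/
def IsHajlaszGradient (μ : Measure X) (cH : ℝ) (K : Set X) (v : X → EReal) (g : X → ℝ≥0∞) : Prop :=
  AEMeasurable g (μ.restrict K) ∧ ∫⁻ x in K, g x ∂μ < ∞ ∧
    ∃ A ⊆ K, μ A = 0 ∧ ∀ x ∈ K \ A, ∀ y ∈ K \ A,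
      edist x y ≤ ENNReal.ofReal cH * min (infEDist x Kᶜ) (infEDist y Kᶜ) →
        (v x - v y).abs ≤ edist x y * (g x + g y)

/-- `v ∈ M^{1,1}_{cH}(K)`. -/
def MemM11 (μ : Measure X) (cH : ℝ) (K : Set X) (v : X → EReal) : Prop :=
  MemL1 μ K v ∧ ∃ g, IsHajlaszGradient μ cH K v g

/-- The norm `‖v‖_{M^{1,1}_{cH}(K)}`. -/
def M11norm (μ : Measure X) (cH : ℝ) (K : Set X) (v : X → EReal) : ℝ≥0∞ :=
  L1norm μ K v + ⨅ (g : X → ℝ≥0∞) (_ : IsHajlaszGradient μ cH K v g), ∫⁻ x in K, g x ∂μ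

/-- The measure `μ` is doubling with constant `Cd`. -/
def IsDoubling (μ : Measure X) (Cd : ℝ) : Prop :=
  ∀ (x : X) (r : ℝ), 0 < r → 0 < μ (ball x (2 * r)) ∧
    μ (ball x (2 * r)) ≤ ENNReal.ofReal Cd * μ (ball x r) ∧ μ (ball x r) < ∞

/-- The mean value `u_B` of a function `u ∈ L¹(B)`; such a function is finite almost everywhere. -/
def mean (μ : Measure X) (u : X → EReal) (B : Set X) : ℝ := ⨍ y in B, (u y).toReal ∂μ

/-- The space supports a `(1,1)`-Poincaré inequality with constants `CP` and `lam`. -/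
def PoincareInequality (μ : Measure X) (CP lam : ℝ) : Prop :=
  ∀ (x : X) (r : ℝ), 0 < r → ∀ (u : X → EReal) (g : X → ℝ≥0∞),
    MemL1Loc μ univ u → IsUpperGradient u g →
      ⨍⁻ y in ball x r, (u y - (mean μ u (ball x r) : EReal)).abs ∂μ
        ≤ ENNReal.ofReal (CP * r) * ⨍⁻ y in ball x (lam * r), g y ∂μ


/-- The balls `B_j = B(x_j, r_j)` form a Whitney covering of `Ω` (with the dilation constant `lam`
and the overlap constant `C₀`); the balls are counted by their indices. -/
structure IsWhitneyCovering {X : Type*} [MetricSpace X] (Ω : Set X) (lam : ℝ) (C₀ : ℕ)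
    (x : ℕ → X) (r : ℕ → ℝ) : Prop where
  center_mem : ∀ j, x j ∈ Ω
  cover : ⋃ j, ball (x j) (r j) = Ω
  radius : ∀ j, r j = infDist (x j) Ωᶜ / (100 * lam)
  overlap : ∀ k, {j | (ball (x k) (20 * lam * r k) ∩
    ball (x j) (20 * lam * r j)).Nonempty}.encard ≤ (C₀ : ℕ∞)
  comparable : ∀ j k, (ball (x k) (20 * lam * r k) ∩ ball (x j) (20 * lam * r j)).Nonempty →
    r j ≤ 2 * r k

/-- `φ_j` is a partition of unity on `Ω` subordinate to the balls `B(x_j, r_j)`: each `φ_j` is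
`c / r_j`-Lipschitz on `Ω`, has values in `[0, 1]`, and vanishes in `Ω` outside `B(x_j, 2 r_j)`. -/
structure IsPartitionOfUnity {X : Type*} [MetricSpace X] (Ω : Set X) (c : ℝ)
    (x : ℕ → X) (r : ℕ → ℝ) (φ : ℕ → X → ℝ) : Prop where
  lipschitz : ∀ j, ∀ y ∈ Ω, ∀ z ∈ Ω, |φ j y - φ j z| ≤ c / r j * dist y z
  support : ∀ j, ∀ y ∈ Ω, y ∉ ball (x j) (2 * r j) → φ j y = 0
  nonneg : ∀ j, ∀ y ∈ Ω, 0 ≤ φ j y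
  le_one : ∀ j, ∀ y ∈ Ω, φ j y ≤ 1
  sum_eq_one : ∀ y ∈ Ω, HasSum (fun j => φ j y) 1

/-- The discrete convolution `u_W = ∑_j u_{B_j} φ_j` (a finite sum at each point of `Ω`). -/
def discreteConvolution (μ : Measure X) (u : X → EReal) (x : ℕ → X) (r : ℕ → ℝ)
    (φ : ℕ → X → ℝ) : X → ℝ :=
  fun y => ∑' j, mean μ u (ball (x j) (r j)) * φ j y

end MetricSobolev

end

/-! Let `y ∈ B_k` and let `z` be within the Hajłasz range of `y`; then `z ∈ 4B_k`. Since the `φ_j`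
sum to one, `u_W(y) - u_W(z)` is the sum of `(u_{B_j} - u_{B_k}) (φ_j(y) - φ_j(z))` over the at most
`C₀` neighbors `j` of `k`. The second factor is at most a constant times `d(y,z) / r_k`. By doubling
and Poincaré on `10B_k`, the first is at most a constant times `r_k` times the mean of an upper
gradient `G` over `10λB_k`. The radii cancel, so `D ∑_k 1_{B_k} ⨍_{10λB_k} G` is a Hajłasz gradient
without exceptional set (`enorm_discreteConvolution_sub_le`, `isHajlaszGradient_whitneyGradient`).
Bounded overlap controls its integral (`lintegral_whitneyGradient_le`); no maximal function enters,
which is why the exponent 1 is allowed.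

The Poincaré inequality concerns functions and genuine upper gradients on all of `X`, whereas `u`
has only a weak one in `Ω`. `IsWeakUpperGradientOn.exists_measurable` removes the exceptional curves
at cost `ε`. `PoincareInequality.local` extends `u` by zero and makes `G` infinite off a ball, so
that curves leaving the ball impose no condition. -/

namespace MetricSobolev

/-! ### Arc-length parametrization and infinite curve integrals. -/

section Curves

variable {X : Type*} [MetricSpace X]

-- The one-sided jumps of the variation function have the size of those of `f`, hence vanish.
open Filter Topology in
theorem continuousOn_variationOnFromTo {f : ℝ → X} {a b : ℝ} (hab : a ≤ b)
    (hf : ContinuousOn f (Icc a b)) (hv : eVariationOn f (Icc a b) < ∞) :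
    ContinuousOn (variationOnFromTo f (Icc a b) a) (Icc a b) := by
  have hbv : LocallyBoundedVariationOn f (Icc a b) :=
    BoundedVariationOn.locallyBoundedVariationOn hv.ne
  intro x hx
  have ha : a ∈ Icc a b := left_mem_Icc.2 hab
  have hl := variationOnFromTo.tendsto_left ha hx hbv
    ((hf x hx).tendsto.mono_left (nhdsWithin_mono x inter_subset_left))
  have hr := variationOnFromTo.tendsto_right ha hx hbv
    ((hf x hx).tendsto.mono_left (nhdsWithin_mono x inter_subset_left))
  simp only [dist_self, sub_zero, add_zero] at hl hr
  have hs : Icc a b ⊆ (Icc a b ∩ Iio x) ∪ {x} ∪ (Icc a b ∩ Ioi x) := by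
    intro y hy
    rcases lt_trichotomy y x with h | h | h
    · exact Or.inl (Or.inl ⟨hy, h⟩)
    · exact Or.inl (Or.inr h)
    · exact Or.inr ⟨hy, h⟩
  refine Tendsto.mono_left ?_ (nhdsWithin_mono x hs)
  rw [nhdsWithin_union, nhdsWithin_union, nhdsWithin_singleton]
  exact (hl.sup (tendsto_pure_nhds _ _)).sup hr

variable (γ : Curve X)

theorem Curve.locallyBoundedVariationOn :
    LocallyBoundedVariationOn γ.toFun (Icc γ.a γ.b) :=
  BoundedVariationOn.locallyBoundedVariationOn γ.rectifiable.ne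

/-- Intermediate value theorem. Unit speed is known only on the range of the variation function;
this makes it available on the whole parameter interval. -/
theorem Curve.image_variationOnFromTo :
    Icc 0 γ.length ⊆ variationOnFromTo γ.toFun (Icc γ.a γ.b) γ.a '' Icc γ.a γ.b := by
  have h := intermediate_value_Icc γ.le
    (continuousOn_variationOnFromTo γ.le γ.continuousOn γ.rectifiable)
  rwa [variationOnFromTo.self, variationOnFromTo.eq_of_le _ _ γ.le, inter_self] at h

theorem Curve.dist_arcParam_le {s t : ℝ} (hs : s ∈ Icc 0 γ.length) (ht : t ∈ Icc 0 γ.length)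
    (hst : s ≤ t) : dist (γ.arcParam s) (γ.arcParam t) ≤ t - s := by
  have hu := has_unit_speed_naturalParameterization γ.toFun γ.locallyBoundedVariationOn
    (left_mem_Icc.2 γ.le)
  have hs' := γ.image_variationOnFromTo hs
  have ht' := γ.image_variationOnFromTo ht
  have h := hu hs' ht'
  have h2 := eVariationOn.edist_le γ.arcParam (x := s) (y := t)
    (s := variationOnFromTo γ.toFun (Icc γ.a γ.b) γ.a '' Icc γ.a γ.b ∩ Icc s t)
    ⟨hs', left_mem_Icc.2 hst⟩ ⟨ht', right_mem_Icc.2 hst⟩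
  unfold Curve.arcParam at h2 ⊢
  rw [h, edist_dist] at h2
  simpa using (ENNReal.ofReal_le_ofReal_iff (by simpa using hst)).1 h2

theorem Curve.exists_arcParam_eq {s : ℝ} (hs : s ∈ Icc γ.a γ.b) :
    ∃ t ∈ Icc 0 γ.length, γ.arcParam t = γ.toFun s := by
  refine ⟨variationOnFromTo γ.toFun (Icc γ.a γ.b) γ.a s,
    ⟨variationOnFromTo.nonneg_of_le _ _ hs.1, ?_⟩, ?_⟩
  · rw [variationOnFromTo.eq_of_le _ _ hs.1]
    exact ENNReal.toReal_mono γ.rectifiable.ne (eVariationOn.mono _ inter_subset_left)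
  · exact edist_eq_zero.1 (edist_naturalParameterization_eq_zero γ.locallyBoundedVariationOn
      (left_mem_Icc.2 γ.le) hs)

theorem Curve.Nonconstant.length_pos {γ : Curve X} (hγ : γ.Nonconstant) : 0 < γ.length := by
  obtain ⟨_, ⟨s, hs, rfl⟩, _, ⟨t, ht, rfl⟩, hne⟩ := hγ
  refine ENNReal.toReal_pos ?_ γ.rectifiable.ne
  exact ((edist_pos.2 hne).trans_le (eVariationOn.edist_le _ hs ht)).ne'

/-- If a function is infinite outside a ball and a nonconstant curve reaches a point outside the
closed ball, then the integral of the function along the curve is infinite. -/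
theorem Curve.Nonconstant.integral_eq_top {γ : Curve X} (hγ : γ.Nonconstant) {x₀ : X} {R : ℝ}
    {g : X → ℝ≥0∞} (hg : ∀ y, R ≤ dist y x₀ → g y = ∞)
    (hout : ¬ γ.image ⊆ closedBall x₀ R) : γ.integral g = ∞ := by
  obtain ⟨_, ⟨s, hs, rfl⟩, hR⟩ := not_subset.1 hout
  obtain ⟨t, ht, hts⟩ := γ.exists_arcParam_eq hs
  rw [mem_closedBall, not_le, ← hts] at hR
  -- The parametrization is 1-Lipschitz, so for parameters within `δ` of `t` the curve stays at
  -- distance at least `R` from `x₀`. Cutting this window to `[0, γ.length]` leaves positive length,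
  -- on which `g` is infinite.
  set δ := dist (γ.arcParam t) x₀ - R with hδ
  have hδ0 : 0 < δ := by linarith
  have hL := hγ.length_pos
  set l := max 0 (t - δ)
  set m := min γ.length (t + δ)
  have hlm : l < m := by
    refine max_lt (lt_min hL ?_) (lt_min ?_ ?_) <;> linarith [ht.1, ht.2]
  have hsub : Icc l m ⊆ Icc 0 γ.length :=
    Icc_subset_Icc (le_max_left _ _) (min_le_left _ _)
  have hinf : ∀ q ∈ Icc l m, g (γ.arcParam q) = ∞ := by
    intro q hq
    refine hg _ ?_
    have h1 : dist (γ.arcParam t) (γ.arcParam q) ≤ δ := by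
      have hq1 : t - δ ≤ q := (le_max_right _ _).trans hq.1
      have hq2 : q ≤ t + δ := hq.2.trans (min_le_right _ _)
      rcases le_total q t with h | h
      · rw [dist_comm]
        linarith [γ.dist_arcParam_le (hsub hq) ht h]
      · linarith [γ.dist_arcParam_le ht (hsub hq) h]
    linarith [dist_triangle (γ.arcParam t) (γ.arcParam q) x₀]
  refine eq_top_iff.2 ?_
  calc (∞ : ℝ≥0∞) = ∫⁻ _ in Icc l m, (∞ : ℝ≥0∞) := by
        rw [setLIntegral_const, Real.volume_Icc, ENNReal.top_mul]
        simpa using hlm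
    _ = ∫⁻ q in Icc l m, g (γ.arcParam q) :=
        setLIntegral_congr_fun measurableSet_Icc fun q hq => (hinf q hq).symm
    _ ≤ γ.integral g := lintegral_mono_set hsub

theorem Curve.integral_mono {g h : X → ℝ≥0∞} (hgh : ∀ y, g y ≤ h y) :
    γ.integral g ≤ γ.integral h :=
  lintegral_mono fun _ => hgh _

end Curves

/-! ### From weak upper gradients to genuine ones. -/

section UpperGradients

variable {X : Type*} [MetricSpace X] [MeasurableSpace X]

/-- A weak upper gradient has Borel majorants with almost the same integral that satisfy the upper
gradient inequality on every curve. -/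
theorem IsWeakUpperGradientOn.exists_measurable {μ : Measure X} {Ω : Set X}
    (hΩ : MeasurableSet Ω) {u : X → EReal} {g : X → ℝ≥0∞} (hg : IsWeakUpperGradientOn μ Ω u g)
    {ε : ℝ≥0∞} (hε : ε ≠ 0) :
    ∃ G : X → ℝ≥0∞, Measurable G ∧
      (∀ γ : Curve X, γ.Nonconstant → γ.image ⊆ Ω → UpperGradientIneq u G γ) ∧
      ∫⁻ x in Ω, G x ∂μ ≤ ∫⁻ x in Ω, g x ∂μ + ε := by
  obtain ⟨hgm, ρ, hρm, hρ, hρtop⟩ := hg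
  obtain ⟨N, hN, hNm, hN0⟩ := exists_measurable_superset_of_null
    (ae_iff.1 ((ae_restrict_iff' hΩ).1 hgm.ae_eq_mk))
  -- However small `κ > 0` is, `κρ` still has infinite integral along every exceptional curve, while
  -- its total mass is below `ε`.
  obtain ⟨κ, hκ0, hκ⟩ := ENNReal.exists_nnreal_pos_mul_lt hρ.ne hε
  set G₀ : X → ℝ≥0∞ := N.indicator (fun _ => ∞) + hgm.mk g with hG₀
  have hG₀m : Measurable G₀ := (measurable_const.indicator hNm).add hgm.measurable_mk
  -- The value `∞` on `N` and off `Ω` gives `g ≤ G₁` everywhere, so that curve integrals compare;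
  -- neither set contributes to the integral over `Ω`.
  set G₁ : X → ℝ≥0∞ := fun y => Ωᶜ.indicator (fun _ => ∞) y + G₀ y with hG₁
  have hG₁m : Measurable G₁ := (measurable_const.indicator hΩ.compl).add hG₀m
  have hgG : ∀ y, g y ≤ G₁ y := by
    intro y
    by_cases hy : y ∈ Ω
    · by_cases hyN : y ∈ N
      · simp [hG₁, hG₀, hyN]
      · have : g y = hgm.mk g y := by
          by_contra h
          exact hyN (hN fun h' => h (h' hy))
        rw [this]
        exact le_add_self.trans le_add_self
    · simp [hG₁, hy]
  have hint : ∫⁻ x in Ω, G₁ x ∂μ = ∫⁻ x in Ω, g x ∂μ := by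
    refine lintegral_congr_ae ?_
    have h0 : ∀ᵐ x ∂(μ.restrict Ω), x ∉ N :=
      ae_restrict_of_ae (measure_eq_zero_iff_ae_notMem.1 hN0)
    filter_upwards [hgm.ae_eq_mk, h0, ae_restrict_mem hΩ] with x h1 h2 h3
    simp [hG₁, hG₀, h2, h3, h1]
  refine ⟨fun y => G₁ y + κ * ρ y, hG₁m.add (hρm.const_mul _), ?_, ?_⟩
  · intro γ hγ hγΩ
    by_cases h : UpperGradientIneq u g γ
    · exact h.trans (γ.integral_mono fun y => (hgG y).trans le_self_add)
    · have h1 : γ.integral (fun y => κ * ρ y) = ∞ := by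
        have : γ.integral (fun y => κ * ρ y) = κ * γ.integral ρ :=
          lintegral_const_mul' _ _ ENNReal.coe_ne_top
        rw [this, hρtop γ ⟨hγ, hγΩ, h⟩, ENNReal.mul_top]
        exact_mod_cast hκ0.ne'
      have h2 : γ.integral (fun y => G₁ y + κ * ρ y) = ∞ :=
        eq_top_iff.2 (h1.symm.le.trans (γ.integral_mono fun y => le_add_self))
      unfold UpperGradientIneq
      rw [h2]
      exact le_top
  · rw [lintegral_add_left hG₁m, hint, lintegral_const_mul _ hρm]
    gcongr
    exact (mul_le_mul_right (setLIntegral_le_lintegral _ _) _).trans hκ.le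

end UpperGradients

/-! ### Mean values of extended real functions. -/

section Means

theorem measurable_ereal_abs : Measurable EReal.abs := by
  have h : EReal.abs = fun x => max x.toENNReal (-x).toENNReal := by
    funext x
    induction x with
    | bot => simp
    | top => simp
    | coe x =>
      rw [EReal.abs_def, ← EReal.coe_neg, EReal.toENNReal_of_ne_top (EReal.coe_ne_top _),
        EReal.toENNReal_of_ne_top (EReal.coe_ne_top _), EReal.toReal_coe, EReal.toReal_coe,
        abs_eq_max_neg]
      exact ENNReal.ofReal_mono.map_max
  rw [h]
  exact measurable_ereal_toENNReal.max (measurable_ereal_toENNReal.comp measurable_neg)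

/-- The default value `0` of `toReal` at `±∞` is harmless, since the right side is then `∞`. -/
theorem enorm_toReal_sub_le (a : EReal) (b : ℝ) : ‖a.toReal - b‖ₑ ≤ (a - b).abs := by
  induction a with
  | bot => simp
  | top => simp
  | coe x =>
    rw [EReal.toReal_coe, ← EReal.coe_sub, EReal.abs_def, Real.enorm_eq_ofReal_abs]

theorem abs_coe_sub_coe (a b : ℝ) : ((a : EReal) - (b : EReal)).abs = ‖a - b‖ₑ := by
  rw [← EReal.coe_sub, EReal.abs_def, Real.enorm_eq_ofReal_abs]

variable {X : Type*} [MeasurableSpace X] {μ : Measure X} {u : X → EReal}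

theorem MemL1.mono {S T : Set X} (h : MemL1 μ T u) (hST : S ⊆ T) : MemL1 μ S u :=
  ⟨h.1.mono_measure (Measure.restrict_mono hST le_rfl),
    (lintegral_mono_set hST).trans_lt h.2⟩

theorem MemL1.integrable_toReal {S : Set X} (h : MemL1 μ S u) :
    IntegrableOn (fun y => (u y).toReal) S μ := by
  refine ⟨(measurable_ereal_toReal.comp_aemeasurable h.1).aestronglyMeasurable, ?_⟩
  refine lt_of_le_of_lt (lintegral_mono fun y => ?_) h.2
  simpa using enorm_toReal_sub_le (u y) 0

theorem MemL1.enorm_mean_sub_le {S : Set X} (h : MemL1 μ S u) (h0 : μ S ≠ 0) (htop : μ S ≠ ∞)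
    (a : ℝ) : ‖mean μ u S - a‖ₑ ≤ (∫⁻ y in S, (u y - a).abs ∂μ) / μ S := by
  have hi := h.integrable_toReal
  have : mean μ u S - a = ⨍ y in S, ((u y).toReal - a) ∂μ := by
    have hm : μ.real S ≠ 0 := (ENNReal.toReal_pos h0 htop).ne'
    rw [mean, setAverage_eq, setAverage_eq,
      integral_sub hi (integrableOn_const htop), setIntegral_const, smul_sub, smul_eq_mul,
      smul_eq_mul, smul_eq_mul, inv_mul_cancel_left₀ hm]
  rw [this, setAverage_eq, enorm_smul, ENNReal.div_eq_inv_mul]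
  gcongr
  · rw [Real.enorm_eq_ofReal (by positivity), measureReal_def,
      ENNReal.ofReal_inv_of_pos (ENNReal.toReal_pos h0 htop), ENNReal.ofReal_toReal htop]
  · exact (enorm_integral_le_lintegral_enorm _).trans
      (lintegral_mono fun y => enorm_toReal_sub_le _ _)

theorem MemL1.enorm_mean_le {S : Set X} (h : MemL1 μ S u) (h0 : μ S ≠ 0) (htop : μ S ≠ ∞) :
    ‖mean μ u S‖ₑ ≤ (∫⁻ y in S, (u y).abs ∂μ) / μ S := by
  simpa using h.enorm_mean_sub_le h0 htop 0

/-- Comparison of a mean over a subset with a number. -/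
theorem MemL1.enorm_mean_sub_le_of_subset {S T : Set X} (h : MemL1 μ T u) (hST : S ⊆ T)
    (h0 : μ S ≠ 0) (htop : μ T ≠ ∞) {K : ℝ≥0∞} (hK : μ T ≤ K * μ S) (a : ℝ) :
    ‖mean μ u S - a‖ₑ ≤ K * ⨍⁻ y in T, (u y - a).abs ∂μ := by
  have hStop : μ S ≠ ∞ := ((measure_mono hST).trans_lt htop.lt_top).ne
  have hT0 : μ T ≠ 0 := fun h => h0 (measure_mono_null hST h)
  refine ((h.mono hST).enorm_mean_sub_le h0 hStop a).trans ?_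
  rw [setLAverage_eq]
  refine ENNReal.div_le_of_le_mul ?_
  calc ∫⁻ y in S, (u y - a).abs ∂μ ≤ ∫⁻ y in T, (u y - a).abs ∂μ := lintegral_mono_set hST
    _ = (∫⁻ y in T, (u y - a).abs ∂μ) / μ T * μ T := (ENNReal.div_mul_cancel hT0 htop).symm
    _ ≤ (∫⁻ y in T, (u y - a).abs ∂μ) / μ T * (K * μ S) := by gcongr
    _ = _ := by ring

end Means

/-! ### Doubling, and localization of the Poincaré inequality. -/

section Balls

variable {X : Type*} [MetricSpace X] [MeasurableSpace X] {μ : Measure X} {Cd : ℝ}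

theorem IsDoubling.measure_ball_pos (hμ : IsDoubling μ Cd) (x : X) {r : ℝ} (hr : 0 < r) :
    μ (ball x r) ≠ 0 := by
  simpa [mul_div_cancel₀] using (hμ x (r / 2) (by positivity)).1.ne'

theorem IsDoubling.measure_ball_ne_top (hμ : IsDoubling μ Cd) (x : X) {r : ℝ} (hr : 0 < r) :
    μ (ball x r) ≠ ∞ := (hμ x r hr).2.2.ne

theorem IsDoubling.measure_ball_pow_le (hμ : IsDoubling μ Cd) (x : X) {r : ℝ} (hr : 0 < r)
    (n : ℕ) : μ (ball x (2 ^ n * r)) ≤ ENNReal.ofReal Cd ^ n * μ (ball x r) := by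
  induction n with
  | zero => simp
  | succ n ih =>
    rw [pow_succ' 2, mul_assoc, pow_succ', mul_assoc]
    exact (hμ x (2 ^ n * r) (by positivity)).2.1.trans (by gcongr)

variable [OpensMeasurableSpace X]

theorem MemL1.memL1Loc_indicator {Ω : Set X} (hΩ : IsOpen Ω) {u : X → EReal}
    (h : MemL1 μ Ω u) : MemL1Loc μ univ (Ω.indicator u) := by
  intro Ω' _ _ _
  refine ⟨((aemeasurable_indicator_iff hΩ.measurableSet).2 h.1).restrict, ?_⟩
  have : (fun y => (Ω.indicator u y).abs) = Ω.indicator fun y => (u y).abs := by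
    funext y
    by_cases hy : y ∈ Ω <;> simp [hy]
  unfold L1norm
  rw [this]
  refine (setLIntegral_le_lintegral _ _).trans_lt ?_
  rw [lintegral_indicator hΩ.measurableSet]
  exact h.2

/-- A local form of the Poincaré inequality: functions and upper gradients are only needed near the
ball. -/
theorem PoincareInequality.local {CP lam : ℝ} (hP : PoincareInequality μ CP lam)
    {Ω : Set X} (hΩ : IsOpen Ω) {u : X → EReal} (hu : MemL1 μ Ω u) {G : X → ℝ≥0∞}
    (hGm : Measurable G)
    (hG : ∀ γ : Curve X, γ.Nonconstant → γ.image ⊆ Ω → UpperGradientIneq u G γ)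
    {x : X} {r : ℝ} (hr : 0 < r) (hlam : 1 ≤ lam) (hsub : closedBall x (lam * r) ⊆ Ω) :
    ⨍⁻ y in ball x r, (u y - (mean μ u (ball x r) : EReal)).abs ∂μ
      ≤ ENNReal.ofReal (CP * r) * ⨍⁻ y in ball x (lam * r), G y ∂μ := by
  set U := ball x (lam * r)
  -- Curves leaving the closed ball have infinite integral; the others lie in `Ω`, where the zero
  -- extension agrees with `u`. The mean over `U` does not see the added term.
  set G' : X → ℝ≥0∞ := fun y => G y + Uᶜ.indicator (fun _ => ∞) y with hG'
  have hUG : IsUpperGradient (Ω.indicator u) G' := by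
    refine ⟨hGm.add (measurable_const.indicator measurableSet_ball.compl), fun γ hγ => ?_⟩
    by_cases hin : γ.image ⊆ closedBall x (lam * r)
    · have hγΩ := hin.trans hsub
      have ha : γ.toFun γ.a ∈ Ω := hγΩ ⟨_, left_mem_Icc.2 γ.le, rfl⟩
      have hb : γ.toFun γ.b ∈ Ω := hγΩ ⟨_, right_mem_Icc.2 γ.le, rfl⟩
      unfold UpperGradientIneq
      rw [indicator_of_mem ha, indicator_of_mem hb]
      exact (hG γ hγ hγΩ).trans (γ.integral_mono fun y => le_self_add)
    · have htop : γ.integral G' = ∞ := by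
        refine hγ.integral_eq_top (fun y hy => ?_) hin
        have : y ∈ Uᶜ := fun h => (mem_ball.1 h).not_ge hy
        simp [hG', this]
      unfold UpperGradientIneq
      rw [htop]
      exact le_top
  have hBΩ : ball x r ⊆ Ω :=
    (ball_subset_ball (by nlinarith)).trans (ball_subset_closedBall.trans hsub)
  have hind : ∀ y ∈ ball x r, Ω.indicator u y = u y := fun y hy => indicator_of_mem (hBΩ hy) u
  have hmean : mean μ (Ω.indicator u) (ball x r) = mean μ u (ball x r) :=
    setAverage_congr_fun measurableSet_ball
      (Filter.Eventually.of_forall fun y hy => by rw [hind y hy])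
  have h := hP x r hr _ _ (hu.memL1Loc_indicator hΩ) hUG
  rw [hmean] at h
  rw [setLAverage_congr_fun measurableSet_ball
    (fun y hy => by simp only [hind y hy] : EqOn (fun y => (Ω.indicator u y -
      (mean μ u (ball x r) : EReal)).abs) (fun y => (u y -
      (mean μ u (ball x r) : EReal)).abs) (ball x r))] at h
  rwa [setLAverage_congr_fun measurableSet_ball
    (fun y hy => by simp [hG', U, mem_ball.1 hy] : EqOn G' G U)] at h

end Balls

/-! ### Geometry and bounded overlap of Whitney balls. -/

section Whitney

variable {X : Type*} [MetricSpace X] {Ω : Set X} {lam : ℝ} {C₀ : ℕ} {x : ℕ → X} {r : ℕ → ℝ}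

namespace IsWhitneyCovering

theorem infDist_center (hW : IsWhitneyCovering Ω lam C₀ x r) (hlam : 1 ≤ lam) (j : ℕ) :
    infDist (x j) Ωᶜ = 100 * lam * r j := by
  rw [hW.radius j]
  field_simp

theorem radius_pos (hW : IsWhitneyCovering Ω lam C₀ x r) (hlam : 1 ≤ lam) (hΩ : IsOpen Ω)
    (hΩc : Ωᶜ.Nonempty) (j : ℕ) : 0 < r j := by
  have h : 0 < infDist (x j) Ωᶜ :=
    (hΩ.isClosed_compl.notMem_iff_infDist_pos hΩc).1 fun h => h (hW.center_mem j)
  rw [hW.infDist_center hlam] at h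
  exact pos_of_mul_pos_right h (by positivity)

theorem closedBall_subset (hW : IsWhitneyCovering Ω lam C₀ x r) (hlam : 1 ≤ lam) (j : ℕ) {s : ℝ}
    (hs : s < 100 * lam * r j) : closedBall (x j) s ⊆ Ω := by
  intro y hy
  by_contra h
  have h1 : infDist (x j) Ωᶜ ≤ dist (x j) y := infDist_le_dist_of_mem h
  rw [hW.infDist_center hlam, dist_comm] at h1
  linarith [mem_closedBall.1 hy]

theorem finite_neighbors (hW : IsWhitneyCovering Ω lam C₀ x r) (k : ℕ) :
    {j | (ball (x k) (20 * lam * r k) ∩ ball (x j) (20 * lam * r j)).Nonempty}.Finite :=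
  finite_of_encard_le_coe (hW.overlap k)

/-- The indices of the balls near the ball with index `k`. -/
noncomputable def neighbors (hW : IsWhitneyCovering Ω lam C₀ x r) (k : ℕ) : Finset ℕ :=
  (hW.finite_neighbors k).toFinset

theorem mem_neighbors (hW : IsWhitneyCovering Ω lam C₀ x r) {k j : ℕ} :
    j ∈ hW.neighbors k ↔
      (ball (x k) (20 * lam * r k) ∩ ball (x j) (20 * lam * r j)).Nonempty := by
  simp [neighbors]

theorem card_neighbors_le (hW : IsWhitneyCovering Ω lam C₀ x r) (k : ℕ) :
    (hW.neighbors k).card ≤ C₀ := by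
  have h := hW.overlap k
  rw [(hW.finite_neighbors k).encard_eq_coe_toFinset_card] at h
  exact_mod_cast h

theorem radius_le (hW : IsWhitneyCovering Ω lam C₀ x r) {k j : ℕ} (h : j ∈ hW.neighbors k) :
    r j ≤ 2 * r k := hW.comparable j k (hW.mem_neighbors.1 h)

theorem le_radius (hW : IsWhitneyCovering Ω lam C₀ x r) {k j : ℕ} (h : j ∈ hW.neighbors k) :
    r k ≤ 2 * r j := hW.comparable k j (by rw [inter_comm]; exact hW.mem_neighbors.1 h)

theorem mem_neighbors_of_mem_ball (hW : IsWhitneyCovering Ω lam C₀ x r) (hlam : 1 ≤ lam)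
    (hr : ∀ j, 0 < r j) {k j : ℕ} {y : X} (hk : y ∈ ball (x k) (4 * r k))
    (hj : y ∈ ball (x j) (2 * r j)) : j ∈ hW.neighbors k :=
  hW.mem_neighbors.2 ⟨y, ball_subset_ball (by nlinarith [hr k]) hk,
    ball_subset_ball (by nlinarith [hr j]) hj⟩

/-- If `y ∈ S k`, every index whose set contains `y` is a neighbor of `k`, and there are at most
`C₀` of these. -/
theorem tsum_indicator_le (hW : IsWhitneyCovering Ω lam C₀ x r) {S : ℕ → Set X}
    (hS : ∀ k, S k ⊆ ball (x k) (20 * lam * r k)) (f : X → ℝ≥0∞) (y : X) :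
    ∑' k, (S k).indicator f y ≤ C₀ * f y := by
  by_cases h : ∃ k, y ∈ S k
  · obtain ⟨k, hk⟩ := h
    rw [tsum_eq_sum (s := hW.neighbors k) fun j hj => indicator_of_notMem (fun hyj => hj
      (hW.mem_neighbors.2 ⟨y, hS k hk, hS j hyj⟩)) f]
    calc ∑ j ∈ hW.neighbors k, (S j).indicator f y ≤ (hW.neighbors k).card • f y :=
          Finset.sum_le_card_nsmul _ _ _ fun j _ => indicator_le_self (S j) f y
      _ ≤ C₀ * f y := by
          rw [nsmul_eq_mul]
          gcongr
          exact hW.card_neighbors_le k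
  · push Not at h
    simp [h]

theorem tsum_setLIntegral_le [MeasurableSpace X] {μ : Measure X}
    (hW : IsWhitneyCovering Ω lam C₀ x r) {S : ℕ → Set X}
    (hSm : ∀ k, MeasurableSet (S k)) (hSΩ : ∀ k, S k ⊆ Ω)
    (hS : ∀ k, S k ⊆ ball (x k) (20 * lam * r k)) {f : X → ℝ≥0∞}
    (hf : AEMeasurable f (μ.restrict Ω)) :
    ∑' k, ∫⁻ y in S k, f y ∂μ ≤ C₀ * ∫⁻ y in Ω, f y ∂μ := by
  calc ∑' k, ∫⁻ y in S k, f y ∂μ = ∑' k, ∫⁻ y in Ω, (S k).indicator f y ∂μ := by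
        refine tsum_congr fun k => ?_
        rw [lintegral_indicator (hSm k), Measure.restrict_restrict (hSm k),
          inter_eq_self_of_subset_left (hSΩ k)]
    _ = ∫⁻ y in Ω, ∑' k, (S k).indicator f y ∂μ :=
        (lintegral_tsum fun k => hf.indicator (hSm k)).symm
    _ ≤ ∫⁻ y in Ω, C₀ * f y ∂μ := lintegral_mono fun y => hW.tsum_indicator_le hS f y
    _ = C₀ * ∫⁻ y in Ω, f y ∂μ := lintegral_const_mul' _ _ (by simp)

/-- Close points of `Ω` lie in a common dilated Whitney ball. -/
theorem mem_ball_of_edist_le (hW : IsWhitneyCovering Ω lam C₀ x r)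
    (hlam : 1 ≤ lam) (hr : ∀ j, 0 < r j) (hΩc : Ωᶜ.Nonempty) {k : ℕ} {y z : X}
    (hy : y ∈ ball (x k) (r k))
    (h : edist y z ≤ ENNReal.ofReal (1 / (50 * lam)) * infEDist y Ωᶜ) :
    z ∈ ball (x k) (4 * r k) := by
  have hrk := hr k
  have hlam0 : 0 < lam := by linarith
  have h1 : dist y z ≤ 1 / (50 * lam) * infDist y Ωᶜ := by
    rw [edist_dist, ← ENNReal.ofReal_toReal (infEDist_ne_top hΩc),
      ← ENNReal.ofReal_mul (by positivity)] at h
    exact (ENNReal.ofReal_le_ofReal_iff (mul_nonneg (by positivity) ENNReal.toReal_nonneg)).1 h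
  have h2 : infDist y Ωᶜ ≤ infDist (x k) Ωᶜ + dist y (x k) := infDist_le_infDist_add_dist
  rw [hW.infDist_center hlam] at h2
  -- `100λ` comes from the center and `1 ≤ λ` from moving to `y`. Then `z` is within `(1 + 101/50)
  -- r_k < 4 r_k` of the center.
  have h3 : infDist y Ωᶜ ≤ 101 * lam * r k := by nlinarith [mem_ball.1 hy]
  have h4 : dist y z ≤ 101 / 50 * r k := by
    refine h1.trans ((mul_le_mul_of_nonneg_left h3 (by positivity)).trans_eq ?_)
    field_simp
  rw [mem_ball]
  linarith [dist_triangle_left z (x k) y, mem_ball.1 hy]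

end IsWhitneyCovering

end Whitney

/-! ### The discrete convolution: local form, continuity, integrability. -/

section DiscreteConvolution

variable {X : Type*} [MetricSpace X] {Ω : Set X} {lam c : ℝ} {C₀ : ℕ} {x : ℕ → X} {r : ℕ → ℝ}
  {φ : ℕ → X → ℝ}

theorem IsPartitionOfUnity.eq_zero_of_notMem_neighbors (hφ : IsPartitionOfUnity Ω c x r φ)
    (hW : IsWhitneyCovering Ω lam C₀ x r) (hlam : 1 ≤ lam) (hr : ∀ j, 0 < r j) {k : ℕ} {y : X}
    (hy : y ∈ Ω) (hk : y ∈ ball (x k) (4 * r k)) {j : ℕ} (hj : j ∉ hW.neighbors k) :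
    φ j y = 0 :=
  hφ.support j y hy fun h => hj (hW.mem_neighbors_of_mem_ball hlam hr hk h)

theorem IsPartitionOfUnity.sum_neighbors (hφ : IsPartitionOfUnity Ω c x r φ)
    (hW : IsWhitneyCovering Ω lam C₀ x r) (hlam : 1 ≤ lam) (hr : ∀ j, 0 < r j) {k : ℕ} {y : X}
    (hy : y ∈ Ω) (hk : y ∈ ball (x k) (4 * r k)) :
    ∑ j ∈ hW.neighbors k, φ j y = 1 := by
  rw [← (hφ.sum_eq_one y hy).tsum_eq,
    tsum_eq_sum fun j hj => hφ.eq_zero_of_notMem_neighbors hW hlam hr hy hk hj]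

variable [MeasurableSpace X] {μ : Measure X} {u : X → EReal}

theorem discreteConvolution_eq_sum (hφ : IsPartitionOfUnity Ω c x r φ)
    (hW : IsWhitneyCovering Ω lam C₀ x r) (hlam : 1 ≤ lam) (hr : ∀ j, 0 < r j) {k : ℕ} {y : X}
    (hy : y ∈ Ω) (hk : y ∈ ball (x k) (4 * r k)) :
    discreteConvolution μ u x r φ y =
      ∑ j ∈ hW.neighbors k, mean μ u (ball (x j) (r j)) * φ j y :=
  tsum_eq_sum fun j hj => by
    rw [hφ.eq_zero_of_notMem_neighbors hW hlam hr hy hk hj, mul_zero]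

/-- One finite index set serves both points, and the `φ_j` over it sum to one at each, so any
constant `a` may be subtracted from the means. It will be `u_{B_k}`. -/
theorem discreteConvolution_sub (hφ : IsPartitionOfUnity Ω c x r φ)
    (hW : IsWhitneyCovering Ω lam C₀ x r) (hlam : 1 ≤ lam) (hr : ∀ j, 0 < r j) {k : ℕ} {y z : X}
    (hy : y ∈ Ω) (hz : z ∈ Ω) (hyk : y ∈ ball (x k) (4 * r k))
    (hzk : z ∈ ball (x k) (4 * r k)) (a : ℝ) :
    discreteConvolution μ u x r φ y - discreteConvolution μ u x r φ z =
      ∑ j ∈ hW.neighbors k, (mean μ u (ball (x j) (r j)) - a) * (φ j y - φ j z) := by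
  rw [discreteConvolution_eq_sum hφ hW hlam hr hy hyk,
    discreteConvolution_eq_sum hφ hW hlam hr hz hzk]
  have h1 := hφ.sum_neighbors hW hlam hr hy hyk
  have h2 := hφ.sum_neighbors hW hlam hr hz hzk
  simp only [sub_mul, mul_sub, Finset.sum_sub_distrib, ← Finset.mul_sum, h1, h2]
  ring

/-- Near each point the series is a fixed finite sum. Continuity serves only to give measurability.
-/
theorem continuousOn_discreteConvolution (hφ : IsPartitionOfUnity Ω c x r φ)
    (hW : IsWhitneyCovering Ω lam C₀ x r) (hlam : 1 ≤ lam) (hr : ∀ j, 0 < r j) (hc : 0 < c) :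
    ContinuousOn (discreteConvolution μ u x r φ) Ω := by
  have hcont : ∀ j, ContinuousOn (φ j) Ω := fun j =>
    (LipschitzOnWith.of_dist_le_mul (K := ⟨c / r j, (div_pos hc (hr j)).le⟩)
      fun y hy z hz => by rw [Real.dist_eq]; exact hφ.lipschitz j y hy z hz).continuousOn
  intro y hy
  have hy' := hy
  rw [← hW.cover, mem_iUnion] at hy'
  obtain ⟨k, hk⟩ := hy'
  have hk4 : y ∈ ball (x k) (4 * r k) := ball_subset_ball (by linarith [hr k]) hk
  have hs : ContinuousOn (fun z => ∑ j ∈ hW.neighbors k,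
      mean μ u (ball (x j) (r j)) * φ j z) Ω :=
    continuousOn_finsetSum _ fun j _ => continuousOn_const.mul (hcont j)
  refine (hs y hy).congr_of_eventuallyEq ?_ (discreteConvolution_eq_sum hφ hW hlam hr hy hk4)
  filter_upwards [self_mem_nhdsWithin, mem_nhdsWithin_of_mem_nhds (isOpen_ball.mem_nhds hk4)]
    with z hz hzk using discreteConvolution_eq_sum hφ hW hlam hr hz hzk

theorem aemeasurable_discreteConvolution [OpensMeasurableSpace X] (hΩ : IsOpen Ω)
    (hφ : IsPartitionOfUnity Ω c x r φ)
    (hW : IsWhitneyCovering Ω lam C₀ x r) (hlam : 1 ≤ lam) (hr : ∀ j, 0 < r j) (hc : 0 < c) :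
    AEMeasurable (fun y => (discreteConvolution μ u x r φ y : EReal)) (μ.restrict Ω) :=
  measurable_coe_real_ereal.comp_aemeasurable
    ((continuousOn_discreteConvolution hφ hW hlam hr hc).aemeasurable hΩ.measurableSet)

variable {Cd : ℝ}

theorem enorm_discreteConvolution_le (hφ : IsPartitionOfUnity Ω c x r φ)
    (hW : IsWhitneyCovering Ω lam C₀ x r) (hlam : 1 ≤ lam) (hr : ∀ j, 0 < r j) {y : X}
    (hy : y ∈ Ω) : ‖discreteConvolution μ u x r φ y‖ₑ ≤ ∑' j, (ball (x j) (2 * r j)).indicator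
      (fun _ => ‖mean μ u (ball (x j) (r j))‖ₑ) y := by
  have hy' := hy
  rw [← hW.cover, mem_iUnion] at hy'
  obtain ⟨k, hk⟩ := hy'
  have hk4 : y ∈ ball (x k) (4 * r k) := ball_subset_ball (by linarith [hr k]) hk
  rw [discreteConvolution_eq_sum hφ hW hlam hr hy hk4]
  refine (enorm_sum_le _ _).trans (le_trans (Finset.sum_le_sum fun j _ => ?_)
    (ENNReal.sum_le_tsum (hW.neighbors k)))
  by_cases hj : y ∈ ball (x j) (2 * r j)
  · rw [indicator_of_mem hj, enorm_mul]
    refine mul_le_of_le_one_right' ?_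
    rw [Real.enorm_eq_ofReal (hφ.nonneg j y hy), ENNReal.ofReal_le_one]
    exact hφ.le_one j y hy
  · simp [hφ.support j y hy hj]

/-- The `j`-th term lives on `2B_j` and contributes at most `|u_{B_j}| μ(2B_j) ≤ Cd ∫_{B_j} |u|`;
bounded overlap sums these. -/
theorem L1norm_discreteConvolution_le [OpensMeasurableSpace X] (hμ : IsDoubling μ Cd)
    (hφ : IsPartitionOfUnity Ω c x r φ) (hW : IsWhitneyCovering Ω lam C₀ x r) (hlam : 1 ≤ lam)
    (hr : ∀ j, 0 < r j) (hΩ : IsOpen Ω) (hu : MemL1 μ Ω u) :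
    L1norm μ Ω (fun y => (discreteConvolution μ u x r φ y : EReal)) ≤
      ENNReal.ofReal Cd * C₀ * L1norm μ Ω u := by
  have hB : ∀ j, ball (x j) (r j) ⊆ Ω := fun j => (subset_iUnion (fun i => ball (x i) (r i)) j).trans hW.cover.le
  calc L1norm μ Ω (fun y => (discreteConvolution μ u x r φ y : EReal))
      = ∫⁻ y in Ω, ‖discreteConvolution μ u x r φ y‖ₑ ∂μ := by
        simp only [L1norm, EReal.abs_def, Real.enorm_eq_ofReal_abs]
    _ ≤ ∫⁻ y in Ω, ∑' j, (ball (x j) (2 * r j)).indicator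
          (fun _ => ‖mean μ u (ball (x j) (r j))‖ₑ) y ∂μ :=
        setLIntegral_mono' hΩ.measurableSet
          fun y hy => enorm_discreteConvolution_le hφ hW hlam hr hy
    _ = ∑' j, ∫⁻ y in Ω, (ball (x j) (2 * r j)).indicator
          (fun _ => ‖mean μ u (ball (x j) (r j))‖ₑ) y ∂μ :=
        lintegral_tsum fun j => (measurable_const.indicator measurableSet_ball).aemeasurable
    _ ≤ ∑' j, ENNReal.ofReal Cd * ∫⁻ y in ball (x j) (r j), (u y).abs ∂μ := by
        refine ENNReal.tsum_le_tsum fun j => ?_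
        have h0 := hμ.measure_ball_pos (x j) (hr j)
        have htop := hμ.measure_ball_ne_top (x j) (hr j)
        rw [lintegral_indicator measurableSet_ball, lintegral_const, Measure.restrict_apply_univ]
        calc ‖mean μ u (ball (x j) (r j))‖ₑ * μ.restrict Ω (ball (x j) (2 * r j))
            ≤ (∫⁻ y in ball (x j) (r j), (u y).abs ∂μ) / μ (ball (x j) (r j)) *
              (ENNReal.ofReal Cd * μ (ball (x j) (r j))) := by
              gcongr
              · exact (hu.mono (hB j)).enorm_mean_le h0 htop
              · exact (Measure.restrict_apply_le _ _).trans (hμ (x j) (r j) (hr j)).2.1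
          _ = ENNReal.ofReal Cd * ((∫⁻ y in ball (x j) (r j), (u y).abs ∂μ) /
              μ (ball (x j) (r j)) * μ (ball (x j) (r j))) := by ring
          _ = _ := by rw [ENNReal.div_mul_cancel h0 htop]
    _ = ENNReal.ofReal Cd * ∑' j, ∫⁻ y in ball (x j) (r j), (u y).abs ∂μ :=
        ENNReal.tsum_mul_left
    _ ≤ ENNReal.ofReal Cd * (C₀ * L1norm μ Ω u) := by
        gcongr
        refine hW.tsum_setLIntegral_le (fun _ => measurableSet_ball) hB
          (fun j => ball_subset_ball ?_) (measurable_ereal_abs.comp_aemeasurable hu.1)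
        nlinarith [hr j]
    _ = _ := by ring

end DiscreteConvolution

/-! ### The Hajłasz gradient of the discrete convolution. -/

section HajlaszGradient

variable {X : Type*} [MetricSpace X] [MeasurableSpace X] {μ : Measure X} {Ω : Set X}
  {Cd CP lam c : ℝ} {C₀ : ℕ} {x : ℕ → X} {r : ℕ → ℝ} {φ : ℕ → X → ℝ} {u : X → EReal}
  {G : X → ℝ≥0∞}

/-- The constant in the pointwise estimate of the discrete convolution. -/
noncomputable def hajlaszConst (Cd CP c : ℝ) (C₀ : ℕ) : ℝ≥0∞ :=
  C₀ * (2 * ENNReal.ofReal Cd ^ 6 * ENNReal.ofReal (20 * CP * c))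

theorem hajlaszConst_ne_top (Cd CP c : ℝ) (C₀ : ℕ) : hajlaszConst Cd CP c C₀ ≠ ∞ := by
  unfold hajlaszConst
  finiteness

/-- A Hajłasz gradient of the discrete convolution: a constant times the sum of the mean values of
`G` over dilated Whitney balls. -/
noncomputable def whitneyGradient (μ : Measure X) (D : ℝ≥0∞) (lam : ℝ) (x : ℕ → X) (r : ℕ → ℝ)
    (G : X → ℝ≥0∞) (y : X) : ℝ≥0∞ :=
  D * ∑' k, (ball (x k) (r k)).indicator
    (fun _ => ⨍⁻ z in ball (x k) (lam * (10 * r k)), G z ∂μ) y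

theorem measurable_whitneyGradient [OpensMeasurableSpace X] (D : ℝ≥0∞) :
    Measurable (whitneyGradient μ D lam x r G) :=
  (Measurable.tsum fun _ => measurable_const.indicator measurableSet_ball).const_mul D

theorem le_whitneyGradient (D : ℝ≥0∞) {k : ℕ} {y : X} (hy : y ∈ ball (x k) (r k)) :
    D * ⨍⁻ z in ball (x k) (lam * (10 * r k)), G z ∂μ ≤ whitneyGradient μ D lam x r G y := by
  unfold whitneyGradient
  gcongr
  refine le_trans ?_ (ENNReal.le_tsum k)
  rw [indicator_of_mem hy]

/-- As `B_k ⊆ 10λB_k`, the mean over the larger ball times `μ(B_k)` is at most the integral of `G`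
over the larger ball. These balls lie in `Ω` because `10 < 100`, and overlap boundedly because `10 <
20`. -/
theorem lintegral_whitneyGradient_le [OpensMeasurableSpace X] (hμ : IsDoubling μ Cd)
    (hW : IsWhitneyCovering Ω lam C₀ x r) (hlam : 1 ≤ lam) (hr : ∀ j, 0 < r j)
    (hG : Measurable G) {D : ℝ≥0∞} (hD : D ≠ ∞) :
    ∫⁻ y in Ω, whitneyGradient μ D lam x r G y ∂μ ≤ D * C₀ * ∫⁻ y in Ω, G y ∂μ := by
  unfold whitneyGradient
  rw [lintegral_const_mul' _ _ hD, mul_assoc]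
  gcongr
  rw [lintegral_tsum fun j => (measurable_const.indicator measurableSet_ball).aemeasurable]
  have hsum := hW.tsum_setLIntegral_le (S := fun k => ball (x k) (lam * (10 * r k)))
    (fun _ => measurableSet_ball) (fun k => ?_) (fun k => ?_) (hG.aemeasurable (μ := μ.restrict Ω))
  · refine le_trans (ENNReal.tsum_le_tsum fun k => ?_) hsum
    have hs : 0 < lam * (10 * r k) := by have := hr k; positivity
    have hle : r k ≤ lam * (10 * r k) := by nlinarith [hr k]
    rw [lintegral_indicator measurableSet_ball, lintegral_const, Measure.restrict_apply_univ,
      setLAverage_eq]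
    calc (∫⁻ z in ball (x k) (lam * (10 * r k)), G z ∂μ) / μ (ball (x k) (lam * (10 * r k))) *
          μ.restrict Ω (ball (x k) (r k))
        ≤ (∫⁻ z in ball (x k) (lam * (10 * r k)), G z ∂μ) / μ (ball (x k) (lam * (10 * r k))) *
          μ (ball (x k) (lam * (10 * r k))) := by
          gcongr
          exact Measure.restrict_le_self
      _ = _ := ENNReal.div_mul_cancel (hμ.measure_ball_pos _ hs) (hμ.measure_ball_ne_top _ hs)
  · refine ball_subset_closedBall.trans (hW.closedBall_subset hlam k ?_)
    nlinarith [mul_pos (zero_lt_one.trans_le hlam) (hr k)]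
  · exact ball_subset_ball (by nlinarith [mul_pos (zero_lt_one.trans_le hlam) (hr k)])

/-- The mean values over neighboring Whitney balls are close. -/
theorem enorm_mean_sub_mean_le (hμ : IsDoubling μ Cd)
    (hW : IsWhitneyCovering Ω lam C₀ x r) (hlam : 1 ≤ lam) (hr : ∀ j, 0 < r j)
    (hu : MemL1 μ Ω u) {j k : ℕ} (hj : j ∈ hW.neighbors k) (hjk : dist (x j) (x k) ≤ 8 * r k)
    {E : ℝ≥0∞} (hE : ⨍⁻ y in ball (x k) (10 * r k),
      (u y - (mean μ u (ball (x k) (10 * r k)) : EReal)).abs ∂μ ≤ E) :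
    ‖mean μ u (ball (x j) (r j)) - mean μ u (ball (x k) (r k))‖ₑ ≤
      2 * ENNReal.ofReal Cd ^ 6 * E := by
  set T := ball (x k) (10 * r k) with hT
  have hrk := hr k
  have hrj := hr j
  have hTΩ : T ⊆ Ω := ball_subset_closedBall.trans (hW.closedBall_subset hlam k (by nlinarith))
  have hTtop : μ T ≠ ∞ := hμ.measure_ball_ne_top _ (by positivity)
  have h1 := hW.radius_le hj
  have h2 := hW.le_radius hj
  -- Both means are compared with the mean over `T = 10B_k`. For `i = j`: `8r_k + r_j ≤ 10r_k` gives
  -- the first inclusion, and `10r_k + 8r_k ≤ 36r_j ≤ 2^6 r_j` the second.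
  have key : ∀ i, ball (x i) (r i) ⊆ T → T ⊆ ball (x i) (2 ^ 6 * r i) →
      ‖mean μ u (ball (x i) (r i)) - mean μ u T‖ₑ ≤ ENNReal.ofReal Cd ^ 6 * E := by
    intro i hi1 hi2
    refine ((hu.mono hTΩ).enorm_mean_sub_le_of_subset hi1 (hμ.measure_ball_pos _ (hr i)) hTtop
      ((measure_mono hi2).trans (hμ.measure_ball_pow_le _ (hr i) 6)) _).trans ?_
    gcongr
  have hj' := key j (ball_subset_ball' (by linarith))
    (ball_subset_ball' (by rw [dist_comm]; linarith))
  have hk' := key k (ball_subset_ball (by linarith)) (ball_subset_ball (by linarith))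
  calc _ = ‖(mean μ u (ball (x j) (r j)) - mean μ u T) -
        (mean μ u (ball (x k) (r k)) - mean μ u T)‖ₑ := by congr 1; ring
    _ ≤ _ := enorm_sub_le
    _ ≤ ENNReal.ofReal Cd ^ 6 * E + ENNReal.ofReal Cd ^ 6 * E := add_le_add hj' hk'
    _ = _ := by ring

theorem enorm_discreteConvolution_sub_le (hμ : IsDoubling μ Cd) (hc : 0 < c) (hCP : 0 < CP)
    (hφ : IsPartitionOfUnity Ω c x r φ) (hW : IsWhitneyCovering Ω lam C₀ x r) (hlam : 1 ≤ lam)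
    (hr : ∀ j, 0 < r j) (hu : MemL1 μ Ω u) {k : ℕ} {A : ℝ≥0∞}
    (hA : ⨍⁻ y in ball (x k) (10 * r k),
      (u y - (mean μ u (ball (x k) (10 * r k)) : EReal)).abs ∂μ ≤
        ENNReal.ofReal (CP * (10 * r k)) * A)
    {y z : X} (hy : y ∈ Ω) (hz : z ∈ Ω) (hyk : y ∈ ball (x k) (4 * r k))
    (hzk : z ∈ ball (x k) (4 * r k)) :
    ‖discreteConvolution μ u x r φ y - discreteConvolution μ u x r φ z‖ₑ ≤
      edist y z * (hajlaszConst Cd CP c C₀ * A) := by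
  rw [discreteConvolution_sub hφ hW hlam hr hy hz hyk hzk (mean μ u (ball (x k) (r k)))]
  set e := edist y z * (2 * ENNReal.ofReal Cd ^ 6 * ENNReal.ofReal (20 * CP * c) * A) with he
  have hrk := hr k
  have hterm : ∀ j ∈ hW.neighbors k, ‖(mean μ u (ball (x j) (r j)) -
      mean μ u (ball (x k) (r k))) * (φ j y - φ j z)‖ₑ ≤ e := by
    intro j hj
    have hrj := hr j
    by_cases hyz : y ∈ ball (x j) (2 * r j) ∨ z ∈ ball (x j) (2 * r j)
    · have h1 := hW.radius_le hj
      have h2 := hW.le_radius hj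
      have hdist : dist (x j) (x k) ≤ 8 * r k := by
        rcases hyz with h | h
        · linarith [dist_triangle_left (x j) (x k) y, mem_ball.1 h, mem_ball.1 hyk]
        · linarith [dist_triangle_left (x j) (x k) z, mem_ball.1 h, mem_ball.1 hzk]
      have hm := enorm_mean_sub_mean_le hμ hW hlam hr hu hj hdist hA
      have hL : ‖φ j y - φ j z‖ₑ ≤ ENNReal.ofReal (2 * c / r k) * edist y z := by
        rw [Real.enorm_eq_ofReal_abs, edist_dist, ← ENNReal.ofReal_mul (by positivity)]
        refine ENNReal.ofReal_le_ofReal ((hφ.lipschitz j y hy z hz).trans ?_)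
        refine mul_le_mul_of_nonneg_right ?_ dist_nonneg
        rw [div_le_div_iff₀ hrj hrk]
        nlinarith
      -- The radius from the Poincaré inequality cancels the one from the Lipschitz constant `c /
      -- r_j ≤ 2c / r_k`.
      have hconst : ENNReal.ofReal (20 * CP * c) =
          ENNReal.ofReal (CP * (10 * r k)) * ENNReal.ofReal (2 * c / r k) := by
        rw [← ENNReal.ofReal_mul (by positivity)]
        congr 1
        field_simp
        ring
      rw [enorm_mul]
      refine (mul_le_mul' hm hL).trans_eq ?_
      rw [he, hconst]
      ring
    · push Not at hyz
      simp [hφ.support j y hy hyz.1, hφ.support j z hz hyz.2]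
  calc _ ≤ _ := enorm_sum_le _ _
    _ ≤ (hW.neighbors k).card • e := Finset.sum_le_card_nsmul _ _ _ hterm
    _ ≤ C₀ * e := by
        rw [nsmul_eq_mul]
        gcongr
        exact hW.card_neighbors_le k
    _ = _ := by rw [he, hajlaszConst]; ring

variable [OpensMeasurableSpace X]

/-- For `y ∈ B_k` the `k`-th term of the gradient at `y` alone dominates the difference quotient;
the value at `z` is not needed. -/
theorem isHajlaszGradient_whitneyGradient (hμ : IsDoubling μ Cd) (hc : 0 < c) (hCP : 0 < CP)
    (hP : PoincareInequality μ CP lam) (hΩ : IsOpen Ω) (hΩc : Ωᶜ.Nonempty)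
    (hφ : IsPartitionOfUnity Ω c x r φ) (hW : IsWhitneyCovering Ω lam C₀ x r) (hlam : 1 ≤ lam)
    (hr : ∀ j, 0 < r j) (hu : MemL1 μ Ω u) (hGm : Measurable G)
    (hG : ∀ γ : Curve X, γ.Nonconstant → γ.image ⊆ Ω → UpperGradientIneq u G γ)
    (hGint : ∫⁻ y in Ω, G y ∂μ ≠ ∞) :
    IsHajlaszGradient μ (1 / (50 * lam)) Ω
      (fun y => (discreteConvolution μ u x r φ y : EReal))
      (whitneyGradient μ (hajlaszConst Cd CP c C₀) lam x r G) := by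
  have hD := hajlaszConst_ne_top Cd CP c C₀
  refine ⟨(measurable_whitneyGradient _).aemeasurable,
    (lintegral_whitneyGradient_le hμ hW hlam hr hGm hD).trans_lt (by finiteness),
    ∅, empty_subset _, measure_empty, fun y hy z hz hyz => ?_⟩
  rw [abs_coe_sub_coe]
  have hy' := hy.1
  rw [← hW.cover, mem_iUnion] at hy'
  obtain ⟨k, hk⟩ := hy'
  have hrk := hr k
  have hk4 : y ∈ ball (x k) (4 * r k) := ball_subset_ball (by linarith) hk
  have hz4 := hW.mem_ball_of_edist_le hlam hr hΩc hk
    (hyz.trans (mul_le_mul_right (min_le_left _ _) _))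
  have hA := hP.local hΩ hu hGm hG (x := x k) (r := 10 * r k) (by positivity) hlam
    (hW.closedBall_subset hlam k (by nlinarith [mul_pos (zero_lt_one.trans_le hlam) hrk]))
  refine (enorm_discreteConvolution_sub_le hμ hc hCP hφ hW hlam hr hu hA hy.1 hz.1 hk4 hz4).trans ?_
  gcongr
  exact (le_whitneyGradient _ hk).trans le_self_add

end HajlaszGradient

end MetricSobolev

/-! ### The norm estimate. -/

theorem theorem4p1 (Cd CP lam c : ℝ) (C₀ : ℕ)
    (hCd : 1 ≤ Cd) (hCP : 0 < CP) (hlam : 1 ≤ lam) (hc : 0 < c) :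
    ∃ C : ℝ, 0 < C ∧
      ∀ (X : Type*) [MetricSpace X] [CompleteSpace X] [MeasurableSpace X] [BorelSpace X]
        (μ : Measure X), MetricSobolev.IsDoubling μ Cd →
        MetricSobolev.PoincareInequality μ CP lam →
      ∀ Ω : Set X, IsOpen Ω → Ω.Nonempty → Ωᶜ.Nonempty →
      ∀ (x : ℕ → X) (r : ℕ → ℝ), MetricSobolev.IsWhitneyCovering Ω lam C₀ x r →
      ∀ φ : ℕ → X → ℝ, MetricSobolev.IsPartitionOfUnity Ω c x r φ →
      ∀ u : X → EReal, MetricSobolev.MemN11 μ Ω u →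
        MetricSobolev.MemM11 μ (1 / (50 * lam)) Ω
          (fun y => (MetricSobolev.discreteConvolution μ u x r φ y : EReal)) ∧
        MetricSobolev.M11norm μ (1 / (50 * lam)) Ω
          (fun y => (MetricSobolev.discreteConvolution μ u x r φ y : EReal))
          ≤ ENNReal.ofReal C * MetricSobolev.N11norm μ Ω u := by
  set D := MetricSobolev.hajlaszConst Cd CP c C₀ with hDdef
  have hD : D ≠ ∞ := MetricSobolev.hajlaszConst_ne_top Cd CP c C₀
  -- The summand `1` keeps `K` nonzero, so that one can divide by it.
  set K : ℝ≥0∞ := ENNReal.ofReal Cd * C₀ + D * C₀ + 1 with hK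
  have hKtop : K ≠ ∞ := by finiteness
  refine ⟨K.toReal, ENNReal.toReal_pos (by simp [hK]) hKtop, ?_⟩
  intro X _ _ _ _ μ hμ hP Ω hΩ _ hΩc x r hW φ hφ u hu
  rw [ENNReal.ofReal_toReal hKtop]
  have hr := hW.radius_pos hlam hΩ hΩc
  have huL : MetricSobolev.MemL1 μ Ω u := ⟨hu.1, le_self_add.trans_lt hu.2⟩
  have hL1 := MetricSobolev.L1norm_discreteConvolution_le hμ hφ hW hlam hr hΩ huL
  have hmain : ∀ g : X → ℝ≥0∞, MetricSobolev.IsWeakUpperGradientOn μ Ω u g →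
      ∫⁻ y in Ω, g y ∂μ ≠ ∞ → ∀ ε : ℝ≥0∞, ε ≠ 0 → ε ≠ ∞ →
      ∃ h, MetricSobolev.IsHajlaszGradient μ (1 / (50 * lam)) Ω
        (fun y => (MetricSobolev.discreteConvolution μ u x r φ y : EReal)) h ∧
        ∫⁻ y in Ω, h y ∂μ ≤ D * C₀ * (∫⁻ y in Ω, g y ∂μ + ε) := by
    intro g hg hgint ε hε hεtop
    obtain ⟨G, hGm, hG, hGint⟩ := hg.exists_measurable hΩ.measurableSet hε
    have hGtop : ∫⁻ y in Ω, G y ∂μ ≠ ∞ :=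
      (hGint.trans_lt (ENNReal.add_lt_top.2 ⟨hgint.lt_top, hεtop.lt_top⟩)).ne
    exact ⟨_, MetricSobolev.isHajlaszGradient_whitneyGradient hμ hc hCP hP hΩ hΩc hφ hW hlam hr
      huL hGm hG hGtop, (MetricSobolev.lintegral_whitneyGradient_le hμ hW hlam hr hGm hD).trans
      (by gcongr)⟩
  constructor
  · refine ⟨⟨MetricSobolev.aemeasurable_discreteConvolution hΩ hφ hW hlam hr hc,
      hL1.trans_lt (ENNReal.mul_lt_top (by finiteness) huL.2)⟩, ?_⟩
    have h := (ENNReal.add_lt_top.1 hu.2).2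
    simp only [iInf_lt_iff] at h
    obtain ⟨g, hg, hgint⟩ := h
    obtain ⟨h, hh, -⟩ := hmain g hg hgint.ne 1 one_ne_zero ENNReal.one_ne_top
    exact ⟨h, hh⟩
  -- `K` is moved to the left while the infimum is reduced to a single `g`, then moved back.
  · refine (ENNReal.div_le_iff' (by simp [hK]) hKtop).1 ?_
    unfold MetricSobolev.N11norm
    rw [ENNReal.add_iInf₂]
    refine le_iInf₂ fun g hg => (ENNReal.div_le_iff' (by simp [hK]) hKtop).2 ?_
    by_cases hgint : ∫⁻ y in Ω, g y ∂μ = ∞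
    · rw [hgint, add_top, ENNReal.mul_top (by simp [hK])]
      exact le_top
    refine ENNReal.le_of_forall_pos_le_add fun ε hε _ => ?_
    -- The loss `ε / K` becomes `ε` after multiplication by `K`.
    obtain ⟨h, hh, hhint⟩ := hmain g hg hgint (ε / K) (by simp [hε.ne', hKtop])
      (ENNReal.div_ne_top ENNReal.coe_ne_top (by simp [hK]))
    have h1 : ENNReal.ofReal Cd * C₀ ≤ K := le_self_add.trans le_self_add
    have h2 : D * C₀ ≤ K := le_add_self.trans le_self_add
    calc _ ≤ ENNReal.ofReal Cd * C₀ * MetricSobolev.L1norm μ Ω u +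
          D * C₀ * (∫⁻ y in Ω, g y ∂μ + ε / K) :=
          add_le_add hL1 ((iInf₂_le h hh).trans hhint)
      _ ≤ K * MetricSobolev.L1norm μ Ω u + K * (∫⁻ y in Ω, g y ∂μ + ε / K) := by gcongr
      _ = _ := by
          rw [mul_add, mul_add, ENNReal.mul_div_cancel (by simp [hK]) hKtop, add_assoc]
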